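/- Let $k$ be a field and let $U$, $A$ be finite-dimensional Hopf algebras over $k$ (coproduct $\Delta$, written $\Delta(a)=a_{(1)}\otimes a_{(2)}$, counit $\epsilon$, antipode $S$) that are dual to each other through a nondegenerate bilinear pairing $\langle\cdot,\cdot\rangle:U\times A\to k$ with $$\langle xy,a\rangle=\langle x,a_{(1)}\rangle\langle y,a_{(2)}\rangle,\quad \langle x,ab\rangle=\langle x_{(1)},a\rangle\langle x_{(2)},b\rangle,\quad \langle 1,a\rangle=\epsilon(a),\quad \langle x,1\rangle=\epsilon(x).$$ Let $\{e_i\}$, $\{f^i\}$ be dual bases of $U$ and $A$, i.e. $\langle e_i,f^j\rangle=\delta_i^j$, and assume that $$\sigma'=\sum_i\langle S^{-2}(e_i),f^i\rangle\neq 0 .$$ Let $U$ be quasitriangular with universal $R$-matrix $\mathcal R=\mathcal R^{(1)}\otimes\mathcal R^{(2)}$; that is, $\mathcal R\in U\otimes U$ is invertible, $\Delta'(x)=\mathcal R\,\Delta(x)\,\mathcal R^{-1}$ for all $x\in U$, where $\Delta'$ is the opposite coproduct, $(\Delta\otimes\mathrm{id})\mathcal R=\mathcal R_{13}\mathcal R_{23}$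 and $(\mathrm{id}\otimes\Delta)\mathcal R=\mathcal R_{13}\mathcal R_{12}$. For $a\in A$ and $x\in U$ put $a\triangleleft x=\langle x,a_{(1)}\rangle a_{(2)}$. Then: 1. The elements $u=S(\mathcal R^{(2)})\mathcal R^{(1)}$ and $s=u\,S(u)\,u^{-2}$ of $U$ are invertible (the invertibility of $u$ gives sense to the definition of $s$), and $$S^4(a)=a\triangleleft s^{-1}\ \text{ for all } a\in A,\qquad S^4(x)=s^{-1}x\ \text{ for all } x\in U.$$ 2. $S^4=\mathrm{id}$, on $U$ and on $A$. 3. For every linear functional $I:A\to k$, written $I(a)=\langle a\rangle$, that is a right invariant integral, i.e. $\langle a_{(1)}\rangle a_{(2)}=\langle a\rangle 1$ for all $a\in A$ (in particular for every biinvariant integral), one has $$\langle ba\rangle=\langle S^2(a)\,b\rangle\quad\text{for all } a,b\in A.$$ -/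

import Mathlib

open scoped TensorProduct

namespace QuantumIntegration

noncomputable section

variable {k U A : Type*} [Field k] [Ring U] [HopfAlgebra k U] [Ring A] [HopfAlgebra k A]

variable (k U A) in
/-- A duality between two Hopf algebras `U` and `A`: a nondegenerate inner product `⟨x, a⟩` that
turns the product and unit of each factor into the coproduct and counit of the other:
`⟨x y, a⟩ = ⟨x, a₍₁₎⟩ ⟨y, a₍₂₎⟩` and `⟨x, a b⟩ = ⟨x₍₁₎, a⟩ ⟨x₍₂₎, b⟩`. -/
structure DualPairing where
  /-- the inner product -/
  pair : U →ₗ[k] A →ₗ[k] k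
  mul_left : ∀ (x y : U) (a : A),
    pair (x * y) a =
      LinearMap.mul' k k (TensorProduct.map (pair x) (pair y) (Coalgebra.comul (R := k) a))
  one_left : ∀ a : A, pair 1 a = Coalgebra.counit (R := k) a
  mul_right : ∀ (x : U) (a b : A),
    pair x (a * b) =
      LinearMap.mul' k k
        (TensorProduct.map (pair.flip a) (pair.flip b) (Coalgebra.comul (R := k) x))
  one_right : ∀ x : U, pair x 1 = Coalgebra.counit (R := k) x
  nondegenerate : pair.Nondegenerate

/-- The right action of `U` on its dual `A`: `a ◁ x = ⟨x, a₍₁₎⟩ a₍₂₎`. -/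
def DualPairing.rightAct (p : DualPairing k U A) (a : A) (x : U) : A :=
  TensorProduct.lid k A ((p.pair x).rTensor A (Coalgebra.comul (R := k) a))

/-- The inverse of the antipode. The antipode of a finite-dimensional Hopf algebra is always
bijective, so there this is a genuine two-sided inverse. -/
def antipodeInv (k U : Type*) [Field k] [Ring U] [HopfAlgebra k U] : Module.End k U :=
  Ring.inverse (HopfAlgebra.antipode k : Module.End k U)

/-- Two (finite) bases `e` of `U` and `f` of `A` are dual: `⟨eᵢ, fʲ⟩ = δᵢʲ`. -/
def DualPairing.IsDualBases (p : DualPairing k U A) {ι : Type*}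
    (e : Module.Basis ι k U) (f : Module.Basis ι k A) : Prop :=
  (∀ i, p.pair (e i) (f i) = 1) ∧ ∀ i j, i ≠ j → p.pair (e i) (f j) = 0

/-- The number `σ' = ∑ᵢ ⟨S⁻²(eᵢ), fⁱ⟩` (for dual bases `e`, `f`). -/
def DualPairing.sigma' (p : DualPairing k U A) {ι : Type*} [Fintype ι]
    (e : Module.Basis ι k U) (f : Module.Basis ι k A) : k :=
  ∑ i, p.pair ((antipodeInv k U ^ 2) (e i)) (f i)

/-- `R₁₂ = R⁽¹⁾ ⊗ R⁽²⁾ ⊗ 1` in `U ⊗ U ⊗ U`. -/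
def leg12 : U ⊗[k] U →ₐ[k] U ⊗[k] (U ⊗[k] U) :=
  Algebra.TensorProduct.map (AlgHom.id k U) Algebra.TensorProduct.includeLeft

/-- `R₁₃ = R⁽¹⁾ ⊗ 1 ⊗ R⁽²⁾` in `U ⊗ U ⊗ U`. -/
def leg13 : U ⊗[k] U →ₐ[k] U ⊗[k] (U ⊗[k] U) :=
  Algebra.TensorProduct.map (AlgHom.id k U) Algebra.TensorProduct.includeRight

/-- `R₂₃ = 1 ⊗ R⁽¹⁾ ⊗ R⁽²⁾` in `U ⊗ U ⊗ U`. -/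
def leg23 : U ⊗[k] U →ₐ[k] U ⊗[k] (U ⊗[k] U) :=
  Algebra.TensorProduct.includeRight

/-- `R` is a universal R-matrix for `U`, i.e. `(U, R)` is a quasitriangular Hopf algebra. -/
structure IsUniversalRMatrix (R : (U ⊗[k] U)ˣ) : Prop where
  /-- `Δ'(x) = R Δ(x) R⁻¹` with `Δ'` the opposite coproduct -/
  comul_op : ∀ x : U,
    TensorProduct.comm k U U (Coalgebra.comul (R := k) x) =
      (R : U ⊗[k] U) * Coalgebra.comul (R := k) x * ((R⁻¹ : (U ⊗[k] U)ˣ) : U ⊗[k] U)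
  /-- `(Δ ⊗ id) R = R₁₃ R₂₃` -/
  comul_left :
    TensorProduct.assoc k U U U
        ((Coalgebra.comul (R := k) (A := U)).rTensor U (R : U ⊗[k] U)) =
      leg13 (R : U ⊗[k] U) * leg23 (R : U ⊗[k] U)
  /-- `(id ⊗ Δ) R = R₁₃ R₁₂` -/
  comul_right :
    (Coalgebra.comul (R := k) (A := U)).lTensor U (R : U ⊗[k] U) =
      leg13 (R : U ⊗[k] U) * leg12 (R : U ⊗[k] U)

/-- The element `S(R⁽²⁾) R⁽¹⁾` of `U`, for `R = R⁽¹⁾ ⊗ R⁽²⁾`. -/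
def drinfeldElement (R : U ⊗[k] U) : U :=
  LinearMap.mul' k U ((HopfAlgebra.antipode k (A := U)).rTensor U (TensorProduct.comm k U U R))

/-- A right invariant integral on `A`: a linear functional with
`⟨a₍₁₎⟩ a₍₂₎ = ⟨a⟩ 1` for all `a`. -/
def IsRightIntegral (I : A →ₗ[k] k) : Prop :=
  ∀ a : A, TensorProduct.lid k A (I.rTensor A (Coalgebra.comul (R := k) a)) = I a • (1 : A)

end

end QuantumIntegration

namespace QuantumIntegration

noncomputable section

open Coalgebra HopfAlgebra LinearMap WithConv

/-! ### Integrals in a Hopf algebra, and an adjoint criterion for `S²`. -/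

section Hopf

variable {k H : Type*} [Field k] [Ring H] [HopfAlgebra k H]

/-! The heart of the matter is `S(u) = u`. It gives `s = 1`, and `S²(x) u = u x` together with its
image under `S` gives `S⁴(x) u = u S²(x) = x u`, so `S⁴ = id` on `U`, and on `A` because the
antipodes are adjoint.

The equality comes from integrals. By cyclicity of the trace, `x ↦ Tr(L_x S⁻²)` is given by a right
integral `t` of `A` with `ε(t) = σ'` (`exists_trace_integral`). Since `σ' ≠ 0`, `t` is two-sided and
fixed by `S`. Exchanging the roles gives such a `y` in `U`, and `⟨y, t⟩ = σ'` because `L_y S⁻²` has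
rank one. Factors slide between the legs of the coproduct of an integral at the cost of an antipode.
Applying `id ⊗ ⟨·, t⟩` to `Δ'(y) R = R Δ(y)` and sliding therefore leaves `u` on one side and `R⁽¹⁾
S(R⁽²⁾) = S(u)` on the other (`antipode_drinfeldElement`).

The same sliding in `Δ(t)`, with both legs evaluated by `⟨y, ·⟩`, gives the trace-like identity for
`⟨y, ·⟩` (`pair_mul_comm_of_integral`), and every right integral on `A` is a multiple of `⟨y, ·⟩`.
-/

lemma sum_counit_smul_left {κ : Type*} {h : H} (r : Repr k h κ) :
    ∑ i ∈ r.index, counit (R := k) (r.right i) • r.left i = h := by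
  have := congr(TensorProduct.rid k H $(sum_tmul_counit_eq (R := k) r))
  simpa only [map_sum, TensorProduct.rid_tmul, one_smul] using this

/-- `∑ (S h₍₁₎ ⊗ 1) Δ(h₍₂₎) = 1 ⊗ h`. -/
lemma sum_antipode_tmul_one_mul_comul {κ : Type*} {h : H} (r : Repr k h κ) :
    ∑ i ∈ r.index, (antipode k (r.left i) ⊗ₜ[k] (1 : H)) * comul (R := k) (r.right i) =
      1 ⊗ₜ[k] h := by
  let i₁ : H →ₐ[k] H ⊗[k] H := Algebra.TensorProduct.includeLeft
  let i₂ : H →ₐ[k] H ⊗[k] H := Algebra.TensorProduct.includeRight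
  -- In the convolution algebra `Hom(H, H ⊗ H)` one has `Δ = i₁ * i₂`, and `i₁ ∘ S` is a left
  -- inverse of `i₁`.
  have h₁ : toConv (i₁.toLinearMap ∘ₗ antipode k) * toConv i₁.toLinearMap = 1 := by
    ext x
    rw [(ℛ k x).convMul_apply]
    simpa using congr(i₁ $(sum_antipode_mul_eq_algebraMap_counit (ℛ k x)))
  have h₂ : toConv i₁.toLinearMap * toConv i₂.toLinearMap = toConv (comul (R := k)) := by
    ext x
    rw [(ℛ k x).convMul_apply]
    simp [i₁, i₂, (ℛ k x).eq]
  have h₃ : toConv (i₁.toLinearMap ∘ₗ antipode k) * toConv (comul (R := k)) =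
      toConv i₂.toLinearMap := by
    rw [← h₂, ← mul_assoc, h₁, one_mul]
  simpa [i₁, i₂, r.convMul_apply] using congr($h₃ h)

/-- `∑ Δ(h₍₁₎) (1 ⊗ S h₍₂₎) = h ⊗ 1`. -/
lemma sum_comul_mul_one_tmul_antipode {κ : Type*} {h : H} (r : Repr k h κ) :
    ∑ i ∈ r.index, comul (R := k) (r.left i) * ((1 : H) ⊗ₜ[k] antipode k (r.right i)) =
      h ⊗ₜ[k] 1 := by
  let i₁ : H →ₐ[k] H ⊗[k] H := Algebra.TensorProduct.includeLeft
  let i₂ : H →ₐ[k] H ⊗[k] H := Algebra.TensorProduct.includeRight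
  have h₁ : toConv i₂.toLinearMap * toConv (i₂.toLinearMap ∘ₗ antipode k) = 1 := by
    ext x
    rw [(ℛ k x).convMul_apply]
    simpa using congr(i₂ $(sum_mul_antipode_eq_algebraMap_counit (ℛ k x)))
  have h₂ : toConv i₁.toLinearMap * toConv i₂.toLinearMap = toConv (comul (R := k)) := by
    ext x
    rw [(ℛ k x).convMul_apply]
    simp [i₁, i₂, (ℛ k x).eq]
  have h₃ : toConv (comul (R := k)) * toConv (i₂.toLinearMap ∘ₗ antipode k) =
      toConv i₁.toLinearMap := by
    rw [← h₂, mul_assoc, h₁, mul_one]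
  simpa [i₁, i₂, r.convMul_apply] using congr($h₃ h)

/-- A left integral moves elements between the legs of its coproduct:
`t₍₁₎ ⊗ h t₍₂₎ = S(h) t₍₁₎ ⊗ t₍₂₎`. -/
lemma one_tmul_mul_comul_of_left_integral {t : H}
    (ht : ∀ h : H, h * t = counit (R := k) h • t) (h : H) :
    (1 ⊗ₜ[k] h) * comul (R := k) t = (antipode k h ⊗ₜ[k] 1) * comul (R := k) t := by
  -- After this expansion each `Δ(h₍₂₎) Δ(t) = Δ(h₍₂₎ t)` collapses to `ε(h₍₂₎) Δ(t)`.
  rw [← sum_antipode_tmul_one_mul_comul (ℛ k h), Finset.sum_mul]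
  simp_rw [mul_assoc, ← Bialgebra.comul_mul, ht, map_smul, mul_smul_comm, ← smul_mul_assoc]
  rw [← Finset.sum_mul]
  congr 1
  simp_rw [TensorProduct.smul_tmul']
  rw [← TensorProduct.sum_tmul]
  simp_rw [← map_smul, ← map_sum]
  rw [sum_counit_smul_left]

/-- A right integral moves elements between the legs of its coproduct:
`t₍₁₎ h ⊗ t₍₂₎ = t₍₁₎ ⊗ t₍₂₎ S(h)`. -/
lemma comul_mul_tmul_one_of_right_integral {t : H}
    (ht : ∀ h : H, t * h = counit (R := k) h • t) (h : H) :
    comul (R := k) t * (h ⊗ₜ[k] 1) = comul (R := k) t * (1 ⊗ₜ[k] antipode k h) := by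
  rw [← sum_comul_mul_one_tmul_antipode (ℛ k h), Finset.mul_sum]
  simp_rw [← mul_assoc, ← Bialgebra.comul_mul, ht, map_smul, smul_mul_assoc, ← mul_smul_comm]
  rw [← Finset.mul_sum]
  congr 1
  simp_rw [← TensorProduct.tmul_smul]
  rw [← TensorProduct.tmul_sum]
  simp_rw [← map_smul, ← map_sum]
  rw [sum_counit_smul]

/-- A right integral with nonzero counit is fixed by a surjective antipode. -/
lemma antipode_eq_self_of_right_integral {t : H}
    (ht : ∀ h : H, t * h = counit (R := k) h • t) (hε : counit (R := k) t ≠ 0)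
    (hS : Function.Surjective (antipode k : H →ₗ[k] H)) : antipode k t = t := by
  have hl : ∀ h : H, h * antipode k t = counit (R := k) h • antipode k t := by
    intro h
    obtain ⟨g, rfl⟩ := hS h
    rw [← antipode_mul_antidistrib, ht, map_smul, counit_antipode]
  -- `t S(t)` equals `ε(t) t` since `t` is a right integral, and `ε(t) S(t)` since `S(t)` is a left
  -- one.
  have h1 := ht (antipode k t)
  rw [hl, counit_antipode] at h1
  exact smul_right_injective _ hε h1

lemma left_integral_of_right_integral {t : H}
    (ht : ∀ h : H, t * h = counit (R := k) h • t) (hε : counit (R := k) t ≠ 0)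
    (hS : Function.Surjective (antipode k : H →ₗ[k] H)) (h : H) :
    h * t = counit (R := k) h • t := by
  obtain ⟨g, rfl⟩ := hS h
  rw [← antipode_eq_self_of_right_integral ht hε hS, ← antipode_mul_antidistrib, ht, map_smul,
    counit_antipode]

/-- If `∑ S(x₍₂₎) w x₍₁₎ = ε(x) w` for all `x`, then `S²(x) w = w x`. -/
lemma antipode_antipode_mul_of_adjoint {w : H}
    (hw : ∀ x : H, ∑ i ∈ (ℛ k x).index,
      antipode k ((ℛ k x).right i) * w * (ℛ k x).left i = counit (R := k) x • w) (x : H) :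
    antipode k (antipode k x) * w = w * x := by
  -- The hypothesis has its factors in reversed order, so it is a convolution identity with values
  -- in the opposite algebra: `id * g = c`. Since also `g * S² = c`, associativity gives `c * S² =
  -- id * c`, which is the claim.
  let o : H →ₗ[k] Hᵐᵒᵖ := (MulOpposite.opLinearEquiv k).toLinearMap
  let g : WithConv (H →ₗ[k] Hᵐᵒᵖ) := toConv (o ∘ₗ mulRight k w ∘ₗ antipode k)
  let j : WithConv (H →ₗ[k] Hᵐᵒᵖ) := toConv (o ∘ₗ antipode k ∘ₗ antipode k)
  let c : WithConv (H →ₗ[k] Hᵐᵒᵖ) := toConv ((counit (R := k)).smulRight (o w))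
  have h₁ : toConv o * g = c := by
    ext x
    rw [(ℛ k x).convMul_apply]
    simpa [o, g, c, mul_assoc] using congr(o $(hw x))
  have h₂ : g * j = c := by
    ext x
    rw [(ℛ k x).convMul_apply]
    have := congr(o (mulRight k w (antipode k $(sum_mul_antipode_eq_smul (ℛ k x)))))
    simpa [o, g, j, c, antipode_mul_antidistrib, Finset.sum_mul, mul_assoc] using this
  have h₃ : c * j = toConv o * c := by rw [← h₁, mul_assoc, h₂, h₁]
  have h₄ := congr($h₃ x)
  rw [(ℛ k x).convMul_apply, (ℛ k x).convMul_apply] at h₄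
  have e₁ : ∑ i ∈ (ℛ k x).index, c ((ℛ k x).left i) * j ((ℛ k x).right i) = o w * j x := by
    conv_rhs => rw [← sum_counit_smul (ℛ k x)]
    simp [c, j, Finset.mul_sum]
  have e₂ : ∑ i ∈ (ℛ k x).index, (toConv o) ((ℛ k x).left i) * c ((ℛ k x).right i) =
      o x * o w := by
    conv_rhs => rw [← sum_counit_smul_left (ℛ k x)]
    simp [c, Finset.sum_mul]
  rw [e₁, e₂] at h₄
  exact MulOpposite.op_injective h₄

end Hopf

/-! ### Dual pairs and the trace integral. -/

namespace DualPairing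

variable {k U A : Type*} [Field k] [Ring U] [HopfAlgebra k U] [Ring A] [HopfAlgebra k A]

/-- The same duality with the two Hopf algebras exchanged. -/
def flip (p : DualPairing k U A) : DualPairing k A U where
  pair := p.pair.flip
  mul_left x y a := p.mul_right a x y
  one_left x := p.one_right x
  mul_right x a b := p.mul_left a b x
  one_right a := p.one_left a
  nondegenerate := ⟨p.nondegenerate.2, p.nondegenerate.1⟩

variable (p : DualPairing k U A)

@[simp] lemma flip_pair_apply (a : A) (x : U) : p.flip.pair a x = p.pair x a := rfl

lemma pair_mul_left {κ : Type*} (x y : U) {a : A} (r : Repr k a κ) :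
    p.pair (x * y) a = ∑ i ∈ r.index, p.pair x (r.left i) * p.pair y (r.right i) := by
  simp [p.mul_left, ← r.eq]

lemma pair_mul_right {κ : Type*} {x : U} (r : Repr k x κ) (a b : A) :
    p.pair x (a * b) = ∑ i ∈ r.index, p.pair (r.left i) a * p.pair (r.right i) b :=
  p.flip.pair_mul_left a b r

lemma ext_left {x y : U} (h : ∀ a, p.pair x a = p.pair y a) : x = y :=
  sub_eq_zero.mp (p.nondegenerate.1 _ fun a => by simp [h a])

lemma ext_right {a b : A} (h : ∀ x, p.pair x a = p.pair x b) : a = b :=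
  p.flip.ext_left h

/-- The antipodes of dual Hopf algebras are adjoint. -/
lemma pair_antipode (x : U) (a : A) : p.pair (antipode k x) a = p.pair x (antipode k a) := by
  -- Both sides of the claim are convolution inverses of the pairing on `U ⊗ A`, one on the left and
  -- one on the right.
  let P : WithConv (U ⊗[k] A →ₗ[k] k) := toConv (TensorProduct.lift p.pair)
  have h₁ : toConv (TensorProduct.lift (p.pair ∘ₗ antipode k)) * P = 1 := by
    apply WithConv.ofConv_injective
    ext x a
    have := congr(p.pair $(sum_antipode_mul_eq_smul (ℛ k x)) a)
    simp only [map_sum, LinearMap.sum_apply, p.pair_mul_left _ _ (ℛ k a), map_smul,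
      LinearMap.smul_apply, p.one_left] at this
    simpa [((ℛ k x).tmul (ℛ k a)).convMul_apply, P, Finset.sum_product, mul_comm] using this
  have h₂ : P * toConv (TensorProduct.lift (p.pair.compl₂ (antipode k))) = 1 := by
    apply WithConv.ofConv_injective
    ext x a
    have := congr(p.pair x $(sum_mul_antipode_eq_smul (ℛ k a)))
    simp only [map_sum, p.pair_mul_right (ℛ k x), map_smul,
      p.one_right] at this
    rw [Finset.sum_comm] at this
    simpa [((ℛ k x).tmul (ℛ k a)).convMul_apply, P, Finset.sum_product, mul_comm] using this
  exact congr($(left_inv_eq_right_inv h₁ h₂) (x ⊗ₜ a))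

/-- The left action of `A` on its dual `U`: `a ▷ x = x₍₁₎ ⟨x₍₂₎, a⟩`. -/
def leftAct : A →ₗ[k] Module.End k U :=
  (TensorProduct.rid k U).toLinearMap.compRight k ∘ₗ
    (LinearMap.lcomp k _ (comul (R := k))) ∘ₗ lTensorHom U ∘ₗ p.pair.flip

lemma leftAct_apply {κ : Type*} (a : A) {x : U} (r : Repr k x κ) :
    p.leftAct a x = ∑ i ∈ r.index, p.pair (r.right i) a • r.left i := by
  simp [leftAct, ← r.eq]

lemma pair_leftAct (a b : A) (x : U) : p.pair (p.leftAct a x) b = p.pair x (b * a) := by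
  simp [p.leftAct_apply a (ℛ k x), p.pair_mul_right (ℛ k x), mul_comm]

lemma leftAct_mul (a b : A) : p.leftAct (a * b) = p.leftAct a * p.leftAct b := by
  ext x
  exact p.ext_left fun c => by simp [pair_leftAct, mul_assoc]

lemma leftAct_one : p.leftAct 1 = 1 := by
  ext x
  exact p.ext_left fun c => by simp [pair_leftAct]

lemma leftAct_mul_apply {κ : Type*} {a : A} (r : Repr k a κ) (x y : U) :
    p.leftAct a (x * y) = ∑ i ∈ r.index, p.leftAct (r.left i) x * p.leftAct (r.right i) y := by
  refine p.ext_left fun b => ?_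
  rw [pair_leftAct, p.pair_mul_left _ _ ((ℛ k b).mul r)]
  simp [Finset.sum_product, p.pair_mul_left _ _ (ℛ k b), pair_leftAct]
  exact Finset.sum_comm

/-- Dual to the multiplicativity of `S²` on `A`. It governs how `S⁻²` passes the action inside the
trace. -/
lemma antipode_sq_comp_leftAct (a : A) :
    (antipode k ∘ₗ antipode k) ∘ₗ p.leftAct (antipode k (antipode k a)) =
      p.leftAct a ∘ₗ (antipode k ∘ₗ antipode k) := by
  ext x
  refine p.ext_left fun b => ?_
  simp [pair_antipode, pair_leftAct, antipode_mul_antidistrib]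

/-- Left multiplication by `a ▷ x` is `a₍₁₎ ▷ (x · (S(a₍₂₎) ▷ -))`. -/
lemma mulLeft_leftAct {κ : Type*} {a : A} (r : Repr k a κ) (x : U) :
    mulLeft k (p.leftAct a x) = ∑ i ∈ r.index,
      p.leftAct (r.left i) * mulLeft k x * p.leftAct (antipode k (r.right i)) := by
  let f : WithConv (A →ₗ[k] Module.End k U) := toConv (LinearMap.mul k U ∘ₗ p.leftAct.flip x)
  let g : WithConv (A →ₗ[k] Module.End k U) := toConv (mulRight k (mulLeft k x) ∘ₗ p.leftAct)
  -- The Leibniz rule for the action, as a convolution identity that can be solved for `f`.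
  have h₁ : f * toConv p.leftAct = g := by
    ext a y
    rw [(ℛ k a).convMul_apply]
    simp [f, g, p.leftAct_mul_apply (ℛ k a)]
  have h₂ : toConv p.leftAct * toConv (p.leftAct ∘ₗ antipode k) = 1 := by
    ext a
    rw [(ℛ k a).convMul_apply]
    have := congr(p.leftAct $(sum_mul_antipode_eq_smul (ℛ k a)))
    simpa [leftAct_mul, leftAct_one, Algebra.algebraMap_eq_smul_one] using congr($this _)
  have h₃ : f = g * toConv (p.leftAct ∘ₗ antipode k) := by
    rw [← h₁, mul_assoc, h₂, mul_one]
  have := congr($h₃ a)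
  rw [r.convMul_apply] at this
  exact this

/-- The functional `x ↦ Tr(y ↦ x T(y))` with `T = S⁻²` is invariant. -/
lemma trace_mulLeft_leftAct {T : Module.End k U}
    (hT : (antipode k ∘ₗ antipode k : Module.End k U) * T = 1)
    (hT' : T * (antipode k ∘ₗ antipode k : Module.End k U) = 1) (a : A) (x : U) :
    trace k U (mulLeft k (p.leftAct a x) * T) =
      counit (R := k) a * trace k U (mulLeft k x * T) := by
  have hc : ∀ b : A, T * p.leftAct b = p.leftAct (antipode k (antipode k b)) * T := fun b => by
    have := p.antipode_sq_comp_leftAct b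
    simp only [← Module.End.mul_eq_comp] at this hT hT'
    calc T * p.leftAct b = T * (p.leftAct b * (antipode k * antipode k)) * T := by
          rw [mul_assoc, mul_assoc, hT, mul_one]
      _ = _ := by rw [← this, ← mul_assoc, hT', one_mul]
  -- Cycling `a₍₁₎ ▷` round the trace and past `T` turns it into `S²(a₍₁₎) ▷`, so the factor
  -- `S(a₍₂₎) S²(a₍₁₎) = S(S(a₍₁₎) a₍₂₎)` appears and collapses to `ε(a)`.
  have := congr(p.leftAct (antipode k $(sum_antipode_mul_eq_smul (ℛ k a))))
  simp only [map_sum, antipode_mul_antidistrib, leftAct_mul, map_smul, antipode_one, leftAct_one]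
    at this
  calc trace k U (mulLeft k (p.leftAct a x) * T)
      = ∑ i ∈ (ℛ k a).index, trace k U (mulLeft k x *
          (p.leftAct (antipode k ((ℛ k a).right i)) *
            p.leftAct (antipode k (antipode k ((ℛ k a).left i)))) * T) := by
        rw [p.mulLeft_leftAct (ℛ k a), Finset.sum_mul, map_sum]
        refine Finset.sum_congr rfl fun i _ => ?_
        rw [mul_assoc, mul_assoc, trace_mul_comm]
        simp only [mul_assoc, hc]
    _ = _ := by
        rw [← map_sum, ← Finset.sum_mul, ← Finset.mul_sum, this]
        simp

variable [FiniteDimensional k U]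

lemma exists_pair_right_eq (φ : U →ₗ[k] k) : ∃ a, ∀ x, p.pair x a = φ x := by
  have hl : Function.Injective p.pair := fun x y h => p.ext_left fun a => congr($h a)
  have hr : Function.Injective p.pair.flip := fun a b h => p.ext_right fun x => congr($h x)
  obtain ⟨a, ha⟩ := (LinearMap.IsPerfPair.of_injective hl hr).bijective_right.2 φ
  exact ⟨a, fun x => congr($ha x)⟩

/-- The trace functional `x ↦ Tr(y ↦ x T(y))`, `T = S⁻²`, on `U` is a right integral of `A`. -/
lemma exists_trace_integral {T : Module.End k U}
    (hT : (antipode k ∘ₗ antipode k : Module.End k U) * T = 1)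
    (hT' : T * (antipode k ∘ₗ antipode k : Module.End k U) = 1) :
    ∃ t : A, (∀ x, p.pair x t = trace k U (mulLeft k x * T)) ∧
      ∀ a, t * a = counit (R := k) a • t := by
  obtain ⟨t, ht⟩ := p.exists_pair_right_eq (trace k U ∘ₗ mulRight k T ∘ₗ LinearMap.mul k U)
  replace ht : ∀ x, p.pair x t = trace k U (mulLeft k x * T) := ht
  refine ⟨t, ht, fun a => p.ext_right fun x => ?_⟩
  rw [← p.pair_leftAct, ht, p.trace_mulLeft_leftAct hT hT', map_smul, ht, smul_eq_mul]

end DualPairing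

/-! ### The R-matrix and the Drinfeld element. -/

section RMatrix

variable {k U : Type*} [Field k] [Ring U] [HopfAlgebra k U]

/-- The linear extension of `a ⊗ b ↦ S(b) a`. -/
def antipodeMul : U ⊗[k] U →ₗ[k] U :=
  mul' k U ∘ₗ (antipode k (A := U)).rTensor U ∘ₗ (TensorProduct.comm k U U).toLinearMap

@[simp] lemma antipodeMul_tmul (a b : U) :
    antipodeMul (k := k) (a ⊗ₜ b) = antipode k b * a := rfl

lemma drinfeldElement_eq_antipodeMul (X : U ⊗[k] U) : drinfeldElement X = antipodeMul X := rfl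

lemma antipodeMul_mul_tmul (X : U ⊗[k] U) (a b : U) :
    antipodeMul (X * a ⊗ₜ[k] b) = antipode k b * antipodeMul X * a := by
  induction X with
  | zero => simp
  | add x y hx hy => simp [add_mul, mul_add, hx, hy]
  | tmul c d => simp [antipode_mul_antidistrib, mul_assoc]

lemma antipodeMul_comul_op_mul (x : U) (X : U ⊗[k] U) :
    antipodeMul (TensorProduct.comm k U U (comul (R := k) x) * X) =
      counit (R := k) x • antipodeMul X := by
  induction X with
  | zero => simp
  | add x y hx hy => simp [mul_add, hx, hy]
  | tmul c d =>
    rw [antipodeMul_mul_tmul, ← (ℛ k x).eq]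
    simp [sum_antipode_mul_eq_smul]

lemma antipode_antipodeMul (X : U ⊗[k] U) :
    antipode k (antipodeMul X) =
      mul' k U ((antipode k).lTensor U (TensorProduct.map (antipode k) (antipode k) X)) := by
  induction X with
  | zero => simp
  | add x y hx hy => simp [hx, hy]
  | tmul c d => simp [antipode_mul_antidistrib]

/-- The linear extension of `a ⊗ (b ⊗ c) ↦ φ(a) b ⊗ c`. -/
def contractLeft (φ : U →ₗ[k] U) : U ⊗[k] (U ⊗[k] U) →ₗ[k] U ⊗[k] U :=
  (mul' k U ∘ₗ φ.rTensor U).rTensor U ∘ₗ (TensorProduct.assoc k U U U).symm.toLinearMap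

/-- The linear extension of `a ⊗ (b ⊗ c) ↦ a ⊗ φ(b) c`. -/
def contractRight (φ : U →ₗ[k] U) : U ⊗[k] (U ⊗[k] U) →ₗ[k] U ⊗[k] U :=
  (mul' k U ∘ₗ φ.rTensor U).lTensor U

lemma contractLeft_leg13_mul_leg23 (φ : U →ₗ[k] U) (X Y : U ⊗[k] U) :
    contractLeft φ (leg13 X * leg23 Y) = φ.rTensor U X * Y := by
  induction X with
  | zero => simp
  | add x y hx hy => simp [add_mul, hx, hy]
  | tmul a b =>
    induction Y with
    | zero => simp
    | add x y hx hy => simp only [map_add, mul_add, hx, hy]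
    | tmul c d => simp [contractLeft, leg13, leg23]

lemma contractRight_leg12_mul_leg13 (φ : U →ₗ[k] U) (X Y : U ⊗[k] U) :
    contractRight φ (leg12 X * leg13 Y) = φ.lTensor U X * Y := by
  induction X with
  | zero => simp
  | add x y hx hy => simp [add_mul, hx, hy]
  | tmul a b =>
    induction Y with
    | zero => simp
    | add x y hx hy => simp only [map_add, mul_add, hx, hy]
    | tmul c d => simp [contractRight, leg12, leg13]

lemma contractLeft_comul (φ : U →ₗ[k] U) (X : U ⊗[k] U) :
    contractLeft φ (TensorProduct.assoc k U U U ((comul (R := k) (A := U)).rTensor U X)) =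
      (mul' k U ∘ₗ φ.rTensor U ∘ₗ comul).rTensor U X := by
  simp [contractLeft, ← LinearMap.rTensor_comp_apply, LinearMap.comp_assoc]

lemma contractRight_comul (φ : U →ₗ[k] U) (X : U ⊗[k] U) :
    contractRight φ ((comul (R := k) (A := U)).lTensor U X) =
      (mul' k U ∘ₗ φ.rTensor U ∘ₗ comul).lTensor U X := by
  simp [contractRight, ← LinearMap.lTensor_comp_apply, LinearMap.comp_assoc]

lemma mul_counit_comul :
    mul' k U ∘ₗ (Algebra.linearMap k U ∘ₗ counit).rTensor U ∘ₗ comul = LinearMap.id := by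
  ext x
  simp only [coe_comp, Function.comp_apply, ← (ℛ k x).eq, map_sum, rTensor_tmul, mul'_apply]
  simp [← Algebra.smul_def, sum_counit_smul]

namespace IsUniversalRMatrix

variable {R : (U ⊗[k] U)ˣ} (hR : IsUniversalRMatrix R)
include hR

lemma comul_op_mul (x : U) :
    TensorProduct.comm k U U (comul (R := k) x) * R = R * comul (R := k) x := by
  rw [hR.comul_op, mul_assoc, Units.inv_mul, mul_one]

/-- Inverting reverses `R₁₃ R₁₂`, which puts the middle leg before the third, the order in which
`contractRight` factors. -/
lemma comul_right_inv :
    (comul (R := k) (A := U)).lTensor U ((R⁻¹ : (U ⊗[k] U)ˣ) : U ⊗[k] U) =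
      leg12 ((R⁻¹ : (U ⊗[k] U)ˣ) : U ⊗[k] U) * leg13 ((R⁻¹ : (U ⊗[k] U)ˣ) : U ⊗[k] U) := by
  let D : U ⊗[k] U →ₐ[k] U ⊗[k] (U ⊗[k] U) :=
    Algebra.TensorProduct.map (AlgHom.id k U) (Bialgebra.comulAlgHom k U)
  have hD : ∀ X, (comul (R := k) (A := U)).lTensor U X = D X := fun X => rfl
  have h := hR.comul_right
  rw [hD] at h ⊢
  have h' : Units.map D.toMonoidHom R =
      Units.map leg13.toMonoidHom R * Units.map leg12.toMonoidHom R := Units.ext h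
  have := congrArg (·⁻¹) h'
  simp only [mul_inv_rev, ← map_inv] at this
  exact congrArg Units.val this

lemma counit_rTensor : (Algebra.linearMap k U ∘ₗ counit).rTensor U (R : U ⊗[k] U) = 1 := by
  have h := congrArg (contractLeft (Algebra.linearMap k U ∘ₗ counit)) hR.comul_left
  rw [contractLeft_comul, contractLeft_leg13_mul_leg23, mul_counit_comul, rTensor_id,
    id_apply] at h
  exact R.mul_left_inj.mp (h.symm.trans (one_mul _).symm)

lemma counit_lTensor_inv :
    (Algebra.linearMap k U ∘ₗ counit).lTensor U ((R⁻¹ : (U ⊗[k] U)ˣ) : U ⊗[k] U) = 1 := by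
  have h := congrArg (contractRight (Algebra.linearMap k U ∘ₗ counit)) hR.comul_right_inv
  rw [contractRight_comul, contractRight_leg12_mul_leg13, mul_counit_comul, lTensor_id,
    id_apply] at h
  exact (R⁻¹).mul_left_inj.mp (h.symm.trans (one_mul _).symm)

/-- `(S ⊗ id) R = R⁻¹`. -/
lemma antipode_rTensor :
    (antipode k).rTensor U (R : U ⊗[k] U) = ((R⁻¹ : (U ⊗[k] U)ˣ) : U ⊗[k] U) := by
  have h := congrArg (contractLeft (antipode k)) hR.comul_left
  rw [contractLeft_comul, contractLeft_leg13_mul_leg23, mul_antipode_rTensor_comul,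
    hR.counit_rTensor] at h
  exact (Units.inv_eq_of_mul_eq_one_left h.symm).symm

/-- `(id ⊗ S) R⁻¹ = R`. -/
lemma antipode_lTensor_inv :
    (antipode k).lTensor U ((R⁻¹ : (U ⊗[k] U)ˣ) : U ⊗[k] U) = R := by
  have h := congrArg (contractRight (antipode k)) hR.comul_right_inv
  rw [contractRight_comul, contractRight_leg12_mul_leg13, mul_antipode_rTensor_comul,
    hR.counit_lTensor_inv] at h
  simpa using (Units.inv_eq_of_mul_eq_one_left h.symm).symm

/-- `(S ⊗ S) R = R`. -/
lemma map_antipode_antipode :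
    TensorProduct.map (antipode k) (antipode k) (R : U ⊗[k] U) = R := by
  rw [← LinearMap.lTensor_comp_rTensor, comp_apply, hR.antipode_rTensor, hR.antipode_lTensor_inv]

/-- `S²(x) u = u x`. -/
lemma antipode_antipode_mul_drinfeldElement (x : U) :
    antipode k (antipode k x) * drinfeldElement (R : U ⊗[k] U) =
      drinfeldElement (R : U ⊗[k] U) * x := by
  refine antipode_antipode_mul_of_adjoint (k := k) (fun x => ?_) x
  rw [drinfeldElement_eq_antipodeMul, ← antipodeMul_comul_op_mul, hR.comul_op_mul,
    ← (ℛ k x).eq, Finset.mul_sum, map_sum]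
  simp_rw [antipodeMul_mul_tmul]

/-- The inverse is `R⁽²⁾ S²(R⁽¹⁾)`: moving `u` inside gives `S²(R⁽²⁾) u S²(R⁽¹⁾) = R⁽²⁾ u R⁽¹⁾`, and
writing this `R` as `(id ⊗ S) R⁻¹` turns it into `antipodeMul` of `R R⁻¹ = 1`. -/
lemma exists_drinfeldElement_mul_eq_one : ∃ v, drinfeldElement (R : U ⊗[k] U) * v = 1 := by
  set u := drinfeldElement (R : U ⊗[k] U) with hu
  let M : U ⊗[k] U →ₗ[k] U :=
    mul' k U ∘ₗ (mulRight k u).rTensor U ∘ₗ (TensorProduct.comm k U U).toLinearMap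
  have h₁ : ∀ X, M ((antipode k).lTensor U X) = antipodeMul ((R : U ⊗[k] U) * X) := fun X => by
    induction X with
    | zero => simp
    | add x y hx hy => simp only [map_add, mul_add, hx, hy]
    | tmul c d => simp [M, antipodeMul_mul_tmul, hu, drinfeldElement_eq_antipodeMul]
  let V : U ⊗[k] U →ₗ[k] U :=
    mul' k U ∘ₗ (antipode k ∘ₗ antipode k).lTensor U ∘ₗ (TensorProduct.comm k U U).toLinearMap
  have h₂ : ∀ X, u * V X = M (TensorProduct.map (antipode k) (antipode k)
      (TensorProduct.map (antipode k) (antipode k) X)) := fun X => by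
    induction X with
    | zero => simp
    | add x y hx hy => simp only [map_add, mul_add, hx, hy]
    | tmul c d =>
      simp [M, V, hu, hR.antipode_antipode_mul_drinfeldElement, mul_assoc]
  refine ⟨V R, ?_⟩
  rw [h₂, hR.map_antipode_antipode, hR.map_antipode_antipode]
  conv_lhs => rw [← hR.antipode_lTensor_inv, h₁, Units.mul_inv]
  simp [Algebra.TensorProduct.one_def]

lemma isUnit_drinfeldElement [FiniteDimensional k U] :
    IsUnit (drinfeldElement (R : U ⊗[k] U)) := by
  obtain ⟨v, hv⟩ := hR.exists_drinfeldElement_mul_eq_one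
  have : IsArtinianRing U := IsArtinianRing.of_finite k U
  exact IsUnit.of_mul_eq_one v hv

/-- If `S(x) = 0` then `u x = S²(x) u = 0`, so `x = 0`; finite dimension does the rest. -/
lemma antipode_bijective [FiniteDimensional k U] :
    Function.Bijective (antipode k : U →ₗ[k] U) := by
  have hi : Function.Injective (antipode k : U →ₗ[k] U) := by
    refine (injective_iff_map_eq_zero _).mpr fun x hx => ?_
    have := hR.antipode_antipode_mul_drinfeldElement x
    rw [hx, map_zero, zero_mul] at this
    exact hR.isUnit_drinfeldElement.mul_right_eq_zero.mp this.symm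
  exact ⟨hi, LinearMap.injective_iff_surjective.mp hi⟩

/-- If a two-sided integral `t` of `U` is paired nontrivially with a functional that is invariant
on `t`, then `S(u) = u`. -/
lemma antipode_drinfeldElement {t : U} (ht : ∀ h : U, t * h = counit (R := k) h • t)
    (ht' : ∀ h : U, h * t = counit (R := k) h • t) (I : U →ₗ[k] k) (c : k) (hc : c ≠ 0)
    (hI : TensorProduct.lid k U (I.rTensor U (comul (R := k) t)) = c • 1)
    (hI' : TensorProduct.rid k U (I.lTensor U (comul (R := k) t)) = c • 1) :
    antipode k (drinfeldElement (R : U ⊗[k] U)) = drinfeldElement (R : U ⊗[k] U) := by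
  let K : U ⊗[k] U →ₗ[k] U := (TensorProduct.rid k U).toLinearMap ∘ₗ I.lTensor U
  have hK₁ : ∀ h X, K ((h ⊗ₜ 1) * X) = h * K X := fun h X => by
    induction X with
    | zero => simp
    | add x y hx hy => simp only [map_add, mul_add, hx, hy]
    | tmul c d => simp [K]
  have hK₂ : ∀ h X, K (X * (h ⊗ₜ 1)) = K X * h := fun h X => by
    induction X with
    | zero => simp
    | add x y hx hy => simp only [map_add, add_mul, hx, hy]
    | tmul c d => simp [K]
  have hK₃ : ∀ X, K (TensorProduct.comm k U U X) = TensorProduct.lid k U (I.rTensor U X) :=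
    fun X => by
      induction X with
      | zero => simp
      | add x y hx hy => simp only [map_add, hx, hy]
      | tmul c d => simp [K]
  -- Sliding the second leg of `X` across `Δ(t)` turns `a ⊗ b` into `a S(b)`; for `X = R` this is
  -- `S(u)`. The mirror computation `hr` produces `u`.
  have hl : ∀ X, K (X * comul (R := k) t) = mul' k U ((antipode k).lTensor U X) * K (comul t) :=
    fun X => by
      induction X with
      | zero => simp
      | add x y hx hy => simp only [map_add, add_mul, hx, hy]
      | tmul a b =>
        rw [show a ⊗ₜ[k] b = (a ⊗ₜ[k] 1) * (1 ⊗ₜ[k] b) by simp, mul_assoc, hK₁,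
          one_tmul_mul_comul_of_left_integral ht', hK₁]
        simp [mul_assoc]
  have hr : ∀ X, K (TensorProduct.comm k U U (comul (R := k) t) * X) =
      K (TensorProduct.comm k U U (comul t)) * antipodeMul X := fun X => by
    induction X with
    | zero => simp
    | add x y hx hy => simp only [map_add, mul_add, hx, hy]
    | tmul a b =>
      have hcomm : ∀ X Y : U ⊗[k] U, TensorProduct.comm k U U X * TensorProduct.comm k U U Y =
          TensorProduct.comm k U U (X * Y) := fun X Y =>
        (map_mul (Algebra.TensorProduct.comm k U U) X Y).symm
      have key : TensorProduct.comm k U U (comul (R := k) t) * (a ⊗ₜ[k] b) =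
          TensorProduct.comm k U U (comul (R := k) t) * ((antipode k b * a) ⊗ₜ[k] 1) := by
        rw [← TensorProduct.comm_tmul k U U b a, ← TensorProduct.comm_tmul k U U 1, hcomm, hcomm,
          show b ⊗ₜ[k] a = (b ⊗ₜ[k] 1) * (1 ⊗ₜ[k] a) by simp, ← mul_assoc,
          comul_mul_tmul_one_of_right_integral ht, mul_assoc]
        simp
      rw [key, hK₂, antipodeMul_tmul]
  have h := congrArg K (hR.comul_op_mul t)
  rw [hr, hl, hK₃, hI, show K (comul t) = _ from hI'] at h
  simp only [smul_mul_assoc, mul_smul_comm, one_mul, mul_one] at h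
  rw [drinfeldElement_eq_antipodeMul, antipode_antipodeMul, hR.map_antipode_antipode]
  exact (smul_right_injective _ hc h).symm

end IsUniversalRMatrix

end RMatrix

/-! ### Integrals paired across the duality. -/

section Duality

variable {k U A : Type*} [Field k] [Ring U] [HopfAlgebra k U] [Ring A] [HopfAlgebra k A]

lemma antipodeInv_mul_antipode (hS : Function.Bijective (antipode k : U →ₗ[k] U)) :
    antipodeInv k U * (antipode k : Module.End k U) = 1 :=
  Ring.inverse_mul_cancel _ ((Module.End.isUnit_iff _).mpr hS)

lemma antipode_mul_antipodeInv (hS : Function.Bijective (antipode k : U →ₗ[k] U)) :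
    (antipode k : Module.End k U) * antipodeInv k U = 1 :=
  Ring.mul_inverse_cancel _ ((Module.End.isUnit_iff _).mpr hS)

lemma antipodeInv_sq_mul (hS : Function.Bijective (antipode k : U →ₗ[k] U)) :
    antipodeInv k U ^ 2 * (antipode k ∘ₗ antipode k : Module.End k U) = 1 := by
  rw [← Module.End.mul_eq_comp, pow_two, mul_assoc, ← mul_assoc (antipodeInv k U) (antipode k),
    antipodeInv_mul_antipode hS, one_mul, antipodeInv_mul_antipode hS]

lemma mul_antipodeInv_sq (hS : Function.Bijective (antipode k : U →ₗ[k] U)) :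
    (antipode k ∘ₗ antipode k : Module.End k U) * antipodeInv k U ^ 2 = 1 := by
  rw [← Module.End.mul_eq_comp, pow_two, mul_assoc, ← mul_assoc (antipode k) (antipodeInv k U),
    antipode_mul_antipodeInv hS, one_mul, antipode_mul_antipodeInv hS]

namespace DualPairing

variable (p : DualPairing k U A)

lemma pair_lid_rTensor_comul (x y : U) (a : A) :
    p.pair x (TensorProduct.lid k A ((p.pair y).rTensor A (comul (R := k) a))) =
      p.pair (y * x) a := by
  rw [p.pair_mul_left _ _ (ℛ k a)]
  nth_rw 1 [← (ℛ k a).eq]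
  simp

lemma pair_rid_lTensor_comul (x y : U) (a : A) :
    p.pair x (TensorProduct.rid k A ((p.pair y).lTensor A (comul (R := k) a))) =
      p.pair (x * y) a := by
  rw [p.pair_mul_left _ _ (ℛ k a)]
  nth_rw 1 [← (ℛ k a).eq]
  simp [mul_comm]

lemma isRightIntegral_pair_iff (y : U) :
    IsRightIntegral (p.pair y) ↔ ∀ x, y * x = counit (R := k) x • y := by
  refine ⟨fun h x => p.ext_left fun a => ?_, fun h a => p.ext_right fun x => ?_⟩
  · rw [← p.pair_lid_rTensor_comul, h a]
    simp [p.one_right, mul_comm]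
  · rw [p.pair_lid_rTensor_comul, h x]
    simp [p.one_right, mul_comm]

lemma rid_lTensor_comul_of_left_integral {y : U} (h : ∀ x, x * y = counit (R := k) x • y)
    (a : A) :
    TensorProduct.rid k A ((p.pair y).lTensor A (comul (R := k) a)) = p.pair y a • 1 := by
  refine p.ext_right fun x => ?_
  rw [p.pair_rid_lTensor_comul, h x]
  simp [p.one_right, mul_comm]

lemma rightAct_one (a : A) : p.rightAct a 1 = a := by
  refine p.ext_right fun x => ?_
  rw [rightAct, p.pair_lid_rTensor_comul, one_mul]

include p in
lemma antipode_bijective_right [FiniteDimensional k A]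
    (hS : Function.Bijective (antipode k : U →ₗ[k] U)) :
    Function.Bijective (antipode k : A →ₗ[k] A) := by
  have hi : Function.Injective (antipode k : A →ₗ[k] A) := by
    refine (injective_iff_map_eq_zero _).mpr fun a ha => p.ext_right fun x => ?_
    obtain ⟨y, rfl⟩ := hS.2 x
    rw [p.pair_antipode, ha]
    simp
  exact ⟨hi, LinearMap.injective_iff_surjective.mp hi⟩

lemma pair_antipodeInv (hU : Function.Bijective (antipode k : U →ₗ[k] U))
    (hA : Function.Bijective (antipode k : A →ₗ[k] A)) (x : U) (a : A) :
    p.pair (antipodeInv k U x) a = p.pair x (antipodeInv k A a) := by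
  have h₁ := LinearMap.congr_fun (antipode_mul_antipodeInv hU) x
  have h₂ := LinearMap.congr_fun (antipode_mul_antipodeInv hA) a
  simp only [Module.End.mul_apply, Module.End.one_apply] at h₁ h₂
  rw [← h₂, ← p.pair_antipode, h₁, h₂]

section Bases

variable {ι : Type*} {e : Module.Basis ι k U} {f : Module.Basis ι k A}

lemma IsDualBases.flip (h : p.IsDualBases e f) : p.flip.IsDualBases f e :=
  ⟨h.1, fun i j hij => h.2 j i hij.symm⟩

lemma IsDualBases.trace_eq_sum [Fintype ι] (h : p.IsDualBases e f) (T : Module.End k U) :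
    trace k U T = ∑ i, p.pair (T (e i)) (f i) := by
  classical
  have hc : ∀ i, e.coord i = p.pair.flip (f i) := fun i => e.ext fun j => by
    by_cases hij : j = i
    · subst hij; simp [h.1]
    · simp [h.2 j i hij, Finsupp.single_eq_of_ne, Ne.symm hij]
  rw [trace_eq_matrix_trace k e, Matrix.trace]
  refine Finset.sum_congr rfl fun i _ => ?_
  simpa [toMatrix_apply] using LinearMap.congr_fun (hc i) (T (e i))

/-- Lets the single hypothesis `σ' ≠ 0` supply integrals on both sides. -/
lemma sigma'_flip [Fintype ι] (hU : Function.Bijective (antipode k : U →ₗ[k] U))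
    (hA : Function.Bijective (antipode k : A →ₗ[k] A)) :
    p.flip.sigma' f e = p.sigma' e f := by
  simp [sigma', pow_two, p.pair_antipodeInv hU hA]

/-- The trace functional of `S⁻²` on `U`, as a two-sided integral of `A`. -/
lemma exists_twoSided_integral [Fintype ι] [FiniteDimensional k U] (h : p.IsDualBases e f)
    (hU : Function.Bijective (antipode k : U →ₗ[k] U))
    (hA : Function.Bijective (antipode k : A →ₗ[k] A)) (hσ : p.sigma' e f ≠ 0) :
    ∃ t : A, (∀ x, p.pair x t = trace k U (mulLeft k x * antipodeInv k U ^ 2)) ∧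
      (∀ a, t * a = counit (R := k) a • t) ∧ (∀ a, a * t = counit (R := k) a • t) ∧
      antipode k t = t ∧ counit (R := k) t = p.sigma' e f := by
  obtain ⟨t, ht, hr⟩ := p.exists_trace_integral (mul_antipodeInv_sq hU) (antipodeInv_sq_mul hU)
  have hε : counit (R := k) t = p.sigma' e f := by
    rw [← p.one_left, ht, mulLeft_one, ← Module.End.one_eq_id, one_mul, h.trace_eq_sum p]
    rfl
  have hε' : counit (R := k) t ≠ 0 := hε ▸ hσ
  exact ⟨t, ht, hr, left_integral_of_right_integral hr hε' hA.2,
    antipode_eq_self_of_right_integral hr hε' hA.2, hε⟩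

end Bases

/-- The trace functional takes a right integral `y` to `ε(y)`. -/
lemma trace_mulLeft_of_right_integral [FiniteDimensional k U] {y : U}
    (hy : ∀ x, y * x = counit (R := k) x • y)
    (hU : Function.Bijective (antipode k : U →ₗ[k] U)) :
    trace k U (mulLeft k y * antipodeInv k U ^ 2) = counit (R := k) y := by
  have hi : ∀ x, counit (R := k) (antipodeInv k U x) = counit (R := k) x := fun x => by
    conv_rhs => rw [show x = antipode k (antipodeInv k U x) from
      (LinearMap.congr_fun (antipode_mul_antipodeInv hU) x).symm]
    rw [counit_antipode]
  -- Since `ε ∘ S⁻² = ε`, the operator is the rank-one map `x ↦ ε(x) y`.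
  have : mulLeft k y * antipodeInv k U ^ 2 = (counit (R := k)).smulRight y := by
    ext x
    simp [pow_two, hy, hi]
  rw [this, trace_smulRight]

/-- The modular property of the integral: `⟨b a⟩ = ⟨S²(a) b⟩`. -/
lemma pair_mul_comm_of_integral {y : U} {t : A} (hyr : ∀ x, y * x = counit (R := k) x • y)
    (hyl : ∀ x, x * y = counit (R := k) x • y) (hyS : antipode k y = y)
    (htr : ∀ a, t * a = counit (R := k) a • t) (htl : ∀ a, a * t = counit (R := k) a • t)
    (hyt : p.pair y t ≠ 0) (a b : A) :
    p.pair y (b * a) = p.pair y (antipode k (antipode k a) * b) := by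
  let L := p.pair y
  let B : A ⊗[k] A →ₗ[k] k := mul' k k ∘ₗ TensorProduct.map L L
  have h₁ : ∀ (c d : A) (X : A ⊗[k] A), B ((1 ⊗ₜ c) * X * (1 ⊗ₜ d)) =
      L (c * TensorProduct.lid k A (L.rTensor A X) * d) := fun c d X => by
    induction X with
    | zero => simp
    | add x y hx hy => simp only [map_add, mul_add, add_mul, hx, hy]
    | tmul u v => simp [B]
  have h₂ : ∀ (c d : A) (X : A ⊗[k] A), B ((c ⊗ₜ 1) * X * (d ⊗ₜ 1)) =
      L (c * TensorProduct.rid k A (L.lTensor A X) * d) := fun c d X => by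
    induction X with
    | zero => simp
    | add x y hx hy => simp only [map_add, mul_add, add_mul, hx, hy]
    | tmul u v => simp [B, mul_comm]
  -- Evaluate `(1 ⊗ S(a)) Δ(t) (b ⊗ 1) = (S²(a) ⊗ 1) Δ(t) (b ⊗ 1)` by the integral on both legs. On
  -- the left `b` slides over as `S(b)`, giving `⟨S(a) S(b)⟩ = ⟨S(b a)⟩ = ⟨b a⟩`; the right gives
  -- `⟨S²(a) b⟩`. The common factor is `⟨y, t⟩`.
  have key := congrArg B (congrArg (· * (b ⊗ₜ[k] (1 : A)))
    (one_tmul_mul_comul_of_left_integral htl (antipode k a)))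
  rw [h₂, mul_assoc, comul_mul_tmul_one_of_right_integral htr, ← mul_assoc, h₁,
    (p.isRightIntegral_pair_iff y).mpr hyr t, p.rid_lTensor_comul_of_left_integral hyl] at key
  simp only [mul_smul_comm, smul_mul_assoc, mul_one, map_smul, smul_eq_mul,
    ← antipode_mul_antidistrib] at key
  rw [← mul_right_injective₀ hyt key]
  change _ = p.pair y _
  rw [← p.pair_antipode, hyS]

/-- Right integrals are unique up to scalars. -/
lemma exists_smul_of_isRightIntegral [FiniteDimensional k A] {y : U}
    (hyl : ∀ x, x * y = counit (R := k) x • y) (hε : counit (R := k) y ≠ 0) {I : A →ₗ[k] k}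
    (hI : IsRightIntegral I) : ∃ c : k, I = c • p.pair y := by
  obtain ⟨z, hz⟩ := p.flip.exists_pair_right_eq I
  obtain rfl : p.pair z = I := LinearMap.ext hz
  -- Computing `z y` in two ways gives `ε(y) z = ε(z) y`.
  have h := (p.isRightIntegral_pair_iff z).mp hI y
  rw [hyl] at h
  refine ⟨(counit (R := k) y)⁻¹ * counit (R := k) z, ?_⟩
  rw [mul_smul, ← map_smul, h, map_smul, inv_smul_smul₀ hε]

end DualPairing

end Duality

end

end QuantumIntegration

/-! ### The main theorem. -/

theorem mainTheorem4
    {k U A : Type*} [Field k]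
    [Ring U] [HopfAlgebra k U] [FiniteDimensional k U]
    [Ring A] [HopfAlgebra k A] [FiniteDimensional k A]
    (p : QuantumIntegration.DualPairing k U A)
    {ι : Type*} [Fintype ι] (e : Module.Basis ι k U) (f : Module.Basis ι k A)
    (hef : p.IsDualBases e f)
    (hσ' : p.sigma' e f ≠ 0)
    (R : (TensorProduct k U U)ˣ) (hR : QuantumIntegration.IsUniversalRMatrix R) :
    (∃ u s : Uˣ,
      (u : U) = QuantumIntegration.drinfeldElement (R : TensorProduct k U U) ∧
      (s : U) = (u : U) * HopfAlgebra.antipode k (u : U) * ((u⁻¹ : Uˣ) : U) ^ 2 ∧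
      (∀ a : A, ((HopfAlgebra.antipode k : Module.End k A) ^ 4) a
        = p.rightAct a ((s⁻¹ : Uˣ) : U)) ∧
      (∀ x : U, ((HopfAlgebra.antipode k : Module.End k U) ^ 4) x = ((s⁻¹ : Uˣ) : U) * x)) ∧
    (∀ x : U, ((HopfAlgebra.antipode k : Module.End k U) ^ 4) x = x) ∧
    (∀ a : A, ((HopfAlgebra.antipode k : Module.End k A) ^ 4) a = a) ∧
    (∀ I : A →ₗ[k] k, QuantumIntegration.IsRightIntegral I →
      ∀ a b : A, I (b * a) = I (((HopfAlgebra.antipode k : Module.End k A) ^ 2) a * b)) := by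
  have hU := hR.antipode_bijective
  have hA := p.antipode_bijective_right hU
  obtain ⟨t, ht, htr, htl, -, -⟩ := p.exists_twoSided_integral hef hU hA hσ'
  obtain ⟨y, -, hyr, hyl, hyS, hyε⟩ := p.flip.exists_twoSided_integral (hef.flip p) hA hU
    (by rwa [p.sigma'_flip hU hA])
  rw [p.sigma'_flip hU hA] at hyε
  have hyt : p.pair y t = p.sigma' e f := by
    rw [ht, QuantumIntegration.DualPairing.trace_mulLeft_of_right_integral hyr hU, hyε]
  obtain ⟨u, hu⟩ := hR.isUnit_drinfeldElement
  have hSu : HopfAlgebra.antipode k (u : U) = u := by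
    rw [hu]
    exact hR.antipode_drinfeldElement hyr hyl (p.flip.pair t) _ (hyt ▸ hσ')
      ((p.flip.isRightIntegral_pair_iff t).mpr htr y)
      (p.flip.rid_lTensor_comul_of_left_integral htl y)
  have hconj : ∀ x : U, HopfAlgebra.antipode k (HopfAlgebra.antipode k x) * u = u * x := by
    intro x
    rw [hu]
    exact hR.antipode_antipode_mul_drinfeldElement x
  -- This is the image of `hconj` under `S`, using `S(u) = u` and the surjectivity of `S`.
  have hconj' : ∀ x : U, (u : U) * HopfAlgebra.antipode k (HopfAlgebra.antipode k x) = x * u := by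
    intro x
    obtain ⟨z, rfl⟩ := hU.2 x
    have := congrArg (HopfAlgebra.antipode k) (hconj z)
    rwa [HopfAlgebra.antipode_mul_antidistrib, HopfAlgebra.antipode_mul_antidistrib, hSu] at this
  have hU4 : ∀ x : U, ((HopfAlgebra.antipode k : Module.End k U) ^ 4) x = x := fun x =>
    u.mul_left_inj.mp ((hconj _).trans (hconj' x))
  have hA4 : ∀ a : A, ((HopfAlgebra.antipode k : Module.End k A) ^ 4) a = a := fun a =>
    p.ext_right fun x => by
      conv_rhs => rw [← hU4 x]
      simp [pow_succ, p.pair_antipode]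
  -- With `S(u) = u`, the element `s = u S(u) u⁻²` is `1`.
  refine ⟨⟨u, 1, hu, ?_, ?_, ?_⟩, hU4, hA4, fun I hI a b => ?_⟩
  · rw [hSu, Units.val_one, ← pow_two, ← Units.val_pow_eq_pow_val, ← Units.val_pow_eq_pow_val,
      ← Units.val_mul, inv_pow, mul_inv_cancel, Units.val_one]
  · simpa [p.rightAct_one] using hA4
  · simpa using hU4
  · obtain ⟨c, rfl⟩ := p.exists_smul_of_isRightIntegral hyl (hyε ▸ hσ') hI
    exact congrArg (c * ·)
      (p.pair_mul_comm_of_integral hyr hyl hyS htr htl (hyt ▸ hσ') a b)
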